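/- Conventions. Let $X$ be a metric space. For $R\ge 0$, $\mathcal N_R(A)=\{x\in X : d(x,A)\le R\}$ denotes the closed $R$-neighbourhood of $A\subseteq X$ (with $\mathcal N_R(\emptyset)=\emptyset$). For a constant $C\ge 1$, a *$C$-coarse median* on $X$ is a map $\mu\colon X^3\to X$ such that, for all $x,y,z,p\in X$, 1. $\mu(x,y,z)=\mu(y,x,z)=\mu(x,z,y)$ and $\mu(x,x,y)=x$; 2. $d\big(\mu(\mu(x,p,y),p,z),\,\mu(x,p,\mu(y,p,z))\big)\le C$; 3. $d(\mu(x,y,z),\mu(p,y,z))\le C\,d(x,p)+C$. The pair $(X,\mu)$ is then a *$C$-coarse median space*. The interval between $x,y\in X$ is $[x,y]=\{\mu(x,y,z) : z\in X\}$, and a subset $A\subseteq X$ is *$D$-quasiconvex* ($D\ge 0$) if $[a_1,a_2]\subseteq\mathcal N_D(A)$ for all $a_1,a_2\in A$. A map $f\colon Y\to Z$ of metric spaces is a *$C$-quasi-isometric embedding* if $C^{-1}d(a,b)-C\le d(f(a),f(b))\le C\,d(a,b)+C$ for all $a,b\in Y$; it is a *$C$-quasi-isometry* if moreover every point of $Z$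 is at distance at most $C$ from some point of $f(Y)$. Subsets of $X$ carry the restricted metric, and $\mathbb R^p$ the Euclidean metric. A space $Y$ is *$C$-quasi-isometric* to $\mathbb R^p$ if there is a $C$-quasi-isometry $Y\to\mathbb R^p$. **Statement.** For all real $C\ge 0$ and all $p\in\mathbb N$ (including $p=0$) there exists a constant $C_1=C_1(C,p)\ge 0$ such that the following holds. Let $(X,\mu)$ be a $C$-coarse median space (so that in effect $C\ge1$) and let $E\subseteq X$ be a subset that is $C$-quasi-isometric to $\mathbb R^p$. Suppose that for every bounded subset $B\subseteq E$ there is a $C$-quasiconvex subset $Y_B\subseteq X$ such that $B\subseteq\mathcal N_C(Y_B)$ and such that there exists a $C$-quasi-isometric embedding $Y_B\to\mathbb R^p$. Then $E$ is $C_1$-quasiconvex. -/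

import Mathlib

universe u

namespace CoarseMedian

/-- `μ` is a `C`-coarse median on the metric space `X`, where `C ≥ 1`. -/
structure IsCoarseMedian {X : Type*} [MetricSpace X] (C : ℝ) (μ : X → X → X → X) : Prop where
  one_le : 1 ≤ C
  symm_left : ∀ x y z, μ x y z = μ y x z
  symm_right : ∀ x y z, μ x y z = μ x z y
  localisation : ∀ x y, μ x x y = x
  coarse_assoc : ∀ x y z p, dist (μ (μ x p y) p z) (μ x p (μ y p z)) ≤ C
  coarse_lipschitz : ∀ x y z p, dist (μ x y z) (μ p y z) ≤ C * dist x p + C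

/-- The interval `[x, y] = {μ(x, y, z) | z ∈ X}`. -/
def interval {X : Type*} (μ : X → X → X → X) (x y : X) : Set X :=
  Set.range (fun z => μ x y z)

/-- `A` is `D`-quasiconvex with respect to `μ`: every interval with endpoints in `A` lies in the
closed `D`-neighbourhood of `A`. -/
def IsQuasiconvex {X : Type*} [MetricSpace X] (μ : X → X → X → X) (D : ℝ) (A : Set X) : Prop :=
  ∀ a₁ ∈ A, ∀ a₂ ∈ A, interval μ a₁ a₂ ⊆ Metric.cthickening D A

/-- `f` is a `C`-quasi-isometric embedding, that is, a `(C, C)`-quasi-isometric embedding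
(a notion used for `C ≥ 1`). -/
def IsQIEmbedding {Y Z : Type*} [MetricSpace Y] [MetricSpace Z] (C : ℝ) (f : Y → Z) : Prop :=
  ∀ a b, C⁻¹ * dist a b - C ≤ dist (f a) (f b) ∧ dist (f a) (f b) ≤ C * dist a b + C

/-- `f` is a `C`-quasi-isometry: a `C`-quasi-isometric embedding with `C`-dense image. -/
def IsQuasiIsometry {Y Z : Type*} [MetricSpace Y] [MetricSpace Z] (C : ℝ) (f : Y → Z) : Prop :=
  IsQIEmbedding C f ∧ ∀ z, ∃ a, dist (f a) z ≤ C

end CoarseMedian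

/-!
The point is that a coarse embedding of a large ball of `ℝᵖ` into `ℝᵖ` is coarsely onto a
proportionally smaller ball: a coarse form of invariance of domain.

Given `a₁, a₂ ∈ E` and `m = μ a₁ a₂ z`, let `B` be the part of `E` lying over a large ball of `ℝᵖ`
centred at the image of `a₁`, and let `Y` be a quasiconvex set for `B`. The composite `ball → B →
Y → ℝᵖ` is a coarse embedding. Since `a₁, a₂` are close to points of `Y`, the quasiconvexity of
`Y` puts `m` close to some `y ∈ Y`, and `y` lies at a distance from `a₁` that is bounded linearly
in `dist a₁ a₂`. If the ball was large enough compared with `dist a₁ a₂`, the image of `y` in `ℝᵖ`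
is therefore close to the image of a point of `B`, with an error that depends on `C` and `p` only.
Hence `y`, and with it `m`, is close to `B ⊆ E`.

Coarse invariance of domain (`exists_dist_le_of_coarse_embedding`) follows Kulpa's argument for
invariance of domain. The coarse embedding `φ` and its coarse inverse are replaced by Lipschitz
maps `ψ` and `G` at bounded distance (`exists_lipschitzWith_approx`), so that `G ∘ ψ` is close to
the identity on the ball of radius `R`. If `ψ` missed the point `c`, a ball about `c` containing
`ψ 0` could be pushed radially onto its boundary sphere, changing `G ∘ ψ` by at most a fixed
multiple of the radius of that ball, which is small compared with `R`. As `G` is Lipschitz, the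
image of that sphere is null, so a small translation makes the resulting map nowhere zero. But a
continuous map on a ball of radius `R` that moves points by at most `R / 2` has a zero
(`exists_zero_of_norm_sub_le`). This follows from the absence of `C¹` retractions of a ball onto
its sphere (`not_retraction_onto_sphere`), which is proved by the method of Milnor and Rogers: for
a map `f` fixing the sphere, the integral of `det D((1 - t) • id + t • f)` over the ball is
polynomial in `t` and, for small `t ≥ 0`, equal to the volume of the ball; hence this also holds
at `t = 1`.
-/

namespace CoarseMedian

open MeasureTheory Metric Set Module
open scoped ENNReal NNReal ContDiff RealInnerProductSpace

/-! ### No continuously differentiable retraction of a ball onto its sphere -/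

section NoRetraction

/-- The constant survives extension by zero because a segment leaving the ball crosses its sphere,
where the map vanishes. -/
theorem lipschitzWith_extend_zero {V : Type*} [NormedAddCommGroup V] [NormedSpace ℝ V]
    {R : ℝ} {K : ℝ≥0} {g : V → V}
    (hg : LipschitzOnWith K g (closedBall 0 R)) (h0 : ∀ x, ‖x‖ = R → g x = 0) :
    LipschitzWith K (fun x => if ‖x‖ ≤ R then g x else 0) := by
  classical
  have key : ∀ a b : V, ‖a‖ ≤ R → R < ‖b‖ → dist (g a) 0 ≤ K * dist a b := by
    intro a b ha hb
    have hc : ContinuousOn (fun t : ℝ => ‖AffineMap.lineMap a b t‖) (Icc 0 1) := by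
      apply Continuous.continuousOn
      exact (AffineMap.lineMap_continuous).norm
    obtain ⟨t, ht, hRt⟩ := intermediate_value_Icc (zero_le_one) hc
      (show R ∈ Icc _ _ by simpa using ⟨ha, hb.le⟩)
    simp only at hRt
    rw [← h0 _ hRt]
    refine (hg.dist_le_mul _ (by simpa using ha) _ (by simp [hRt])).trans ?_
    gcongr
    rw [dist_comm, dist_lineMap_left, Real.norm_of_nonneg ht.1]
    exact mul_le_of_le_one_left dist_nonneg ht.2
  refine LipschitzWith.of_dist_le_mul fun a b => ?_
  by_cases ha : ‖a‖ ≤ R <;> by_cases hb : ‖b‖ ≤ R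
  · simp only [ha, hb, if_true]
    exact hg.dist_le_mul _ (by simpa using ha) _ (by simpa using hb)
  · simp only [ha, hb, if_true, if_false]
    exact key a b ha (not_le.1 hb)
  · simp only [ha, hb, if_true, if_false]
    rw [dist_comm, dist_comm a b]
    exact key b a hb (not_le.1 ha)
  · simp only [ha, hb, if_false, dist_self]
    positivity

variable {V : Type*} [NormedAddCommGroup V] [InnerProductSpace ℝ V] [FiniteDimensional ℝ V]

/-- Since `det (1 + t • A)` is a polynomial in `t` of degree at most `finrank ℝ V`, its value at
`t = 1` is a combination of its values at any `finrank ℝ V + 1` points, with coefficients that do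
not depend on `A`. Taking these points small transfers information from small `t` to `t = 1`. -/
theorem det_one_add_eq_sum_lagrange (A : V →L[ℝ] V) {s : Finset ℝ} (hs : finrank ℝ V < s.card) :
    (1 + A).det = ∑ t ∈ s, (Lagrange.basis s id t).eval 1 * (1 + t • A).det := by
  let b := finBasis ℝ V
  let M := LinearMap.toMatrix b b (A : V →ₗ[ℝ] V)
  let q : Polynomial ℝ := Matrix.det
    ((Polynomial.X : Polynomial ℝ) • M.map Polynomial.C +
      (1 : Matrix (Fin (finrank ℝ V)) (Fin (finrank ℝ V)) ℝ).map Polynomial.C)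
  have hq : ∀ t : ℝ, q.eval t = (1 + t • A).det := by
    intro t
    have h1 : (1 + t • A).det = Matrix.det (1 + t • M) := by
      rw [ContinuousLinearMap.det, ← LinearMap.det_toMatrix b]
      congr 1
      simp [M, LinearMap.toMatrix_one]
    rw [h1]
    simp only [q]
    rw [← Polynomial.coe_evalRingHom, RingHom.map_det]
    congr 1
    ext i j
    simp [Matrix.one_apply, apply_ite, add_comm]
    ring
  have hdeg : q.degree < s.card := by
    refine lt_of_le_of_lt Polynomial.degree_le_natDegree ?_
    have h := Polynomial.natDegree_det_X_add_C_le M 1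
    rw [Fintype.card_fin] at h
    exact_mod_cast h.trans_lt hs
  have h := Lagrange.eq_interpolate_of_eval_eq (v := id) (r := fun t => (1 + t • A).det)
    (Set.injOn_id _) hdeg (fun t _ => by simpa using hq t)
  have h1 := hq 1
  rw [one_smul] at h1
  rw [← h1, h, Lagrange.interpolate_apply, Polynomial.eval_finsetSum]
  refine Finset.sum_congr rfl fun t _ => ?_
  simp [mul_comm]

theorem sum_lagrange_basis_eval {s : Finset ℝ} (hs : s.Nonempty) (x : ℝ) :
    ∑ t ∈ s, (Lagrange.basis s id t).eval x = 1 := by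
  rw [← Polynomial.eval_finsetSum, Lagrange.sum_basis (Set.injOn_id _) hs, Polynomial.eval_one]

/-- A perturbation of the identity by a map with Lipschitz constant less than `1` is a bijection of
`V`; it fixes the complement of the ball, so it preserves the ball. -/
theorem image_ball_one_add_smul {R t : ℝ} {K : ℝ≥0} {u : V → V} (hu : LipschitzWith K u)
    (h0 : ∀ x, R ≤ ‖x‖ → u x = 0) (ht : 0 ≤ t) (htK : t * K < 1) :
    Function.Injective (fun x => x + t • u x) ∧
      (fun x => x + t • u x) '' ball 0 R = ball 0 R := by
  set F : V → V := fun x => x + t • u x with hF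
  have happ : ApproximatesLinearOn F ((ContinuousLinearEquiv.refl ℝ V : V ≃L[ℝ] V) : V →L[ℝ] V)
      univ (t.toNNReal * K) := by
    rw [ApproximatesLinearOn.approximatesLinearOn_iff_lipschitzOnWith]
    have : F - ⇑((ContinuousLinearEquiv.refl ℝ V : V ≃L[ℝ] V) : V →L[ℝ] V) = fun x => t • u x := by
      ext x; simp [hF]
    rw [this]
    refine LipschitzOnWith.of_dist_le_mul fun a _ b _ => ?_
    rw [dist_smul₀, Real.norm_of_nonneg ht]
    rw [NNReal.coe_mul, Real.coe_toNNReal t ht, mul_assoc]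
    gcongr
    exact hu.dist_le_mul a b
  have hc : Subsingleton V ∨ (t.toNNReal * K : ℝ≥0) <
      ‖((ContinuousLinearEquiv.refl ℝ V).symm : V →L[ℝ] V)‖₊⁻¹ := by
    rcases subsingleton_or_nontrivial V with h | h
    · exact Or.inl h
    · right
      have : ‖((ContinuousLinearEquiv.refl ℝ V).symm : V →L[ℝ] V)‖₊ = 1 := by
        ext
        exact ContinuousLinearMap.norm_id
      rw [this, inv_one]
      rwa [← NNReal.coe_lt_coe, NNReal.coe_mul, Real.coe_toNNReal t ht]
  have hinj : Function.Injective F := injOn_univ.1 (happ.injOn hc)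
  have hsurj : Function.Surjective F := happ.surjective hc
  refine ⟨hinj, ?_⟩
  have hfix : ∀ x, R ≤ ‖x‖ → F x = x := fun x hx => by simp [hF, h0 x hx]
  ext y
  simp only [mem_image, mem_ball_zero_iff]
  constructor
  · rintro ⟨x, hx, rfl⟩
    by_contra hy
    have := hinj (hfix _ (not_lt.1 hy))
    rw [this] at hy
    exact hy hx
  · intro hy
    obtain ⟨x, rfl⟩ := hsurj y
    refine ⟨x, ?_, rfl⟩
    by_contra hx
    rw [hfix x (not_lt.1 hx)] at hy
    exact hx hy

/-- For small `t ≥ 0` the map `id + t • (f - id)` is a bijection of the ball with positive Jacobian,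
so its Jacobian integrates to the volume; Lagrange interpolation carries this over to `t = 1`. -/
theorem setIntegral_det_fderiv_eq_volume [MeasurableSpace V] [BorelSpace V] {R : ℝ}
    {f : V → V} (hf : ContDiff ℝ 1 f) (hid : ∀ x, ‖x‖ = R → f x = x) :
    ∫ x in ball (0 : V) R, (fderiv ℝ f x).det = (volume : Measure V).real (ball 0 R) := by
  classical
  obtain ⟨K, hK⟩ : ∃ K, LipschitzOnWith K (fun x => f x - x) (closedBall (0 : V) R) :=
    (hf.sub contDiff_id).contDiffOn.exists_lipschitzOnWith one_ne_zero (convex_closedBall _ _)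
      (isCompact_closedBall _ _)
  set u : V → V := fun x => if ‖x‖ ≤ R then f x - x else 0 with hu_def
  have hu : LipschitzWith K u :=
    lipschitzWith_extend_zero hK fun x hx => by simp [hid x hx]
  have hu0 : ∀ x, R ≤ ‖x‖ → u x = 0 := by
    intro x hx
    simp only [hu_def]
    split_ifs with h
    · simp [hid x (le_antisymm h hx)]
    · rfl
  let A : V → V →L[ℝ] V := fun x => fderiv ℝ f x - 1
  have hA : Continuous A := (hf.continuous_fderiv one_ne_zero).sub continuous_const
  have huA : ∀ x ∈ ball (0 : V) R, HasFDerivAt u (A x) x := by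
    intro x hx
    have h1 : HasFDerivAt (fun x => f x - x) (A x) x :=
      (hf.differentiable one_ne_zero x).hasFDerivAt.sub (hasFDerivAt_id x)
    refine h1.congr_of_eventuallyEq ?_
    filter_upwards [isOpen_ball.mem_nhds hx] with y hy
    simp [hu_def, (mem_ball_zero_iff.1 hy).le]
  obtain ⟨M, hM⟩ : ∃ M, ∀ x ∈ closedBall (0 : V) R, ‖A x‖ ≤ M :=
    (isCompact_closedBall _ _).exists_bound_of_continuousOn hA.continuousOn
  obtain ⟨δ, hδ, hdet⟩ : ∃ δ : ℝ, 0 < δ ∧ ∀ B : V →L[ℝ] V, ‖B‖ < δ → 0 < (1 + B).det := by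
    have hc : Continuous fun B : V →L[ℝ] V => (1 + B).det :=
      ContinuousLinearMap.continuous_det.comp (continuous_const.add continuous_id)
    have h1 : ∀ᶠ B in nhds (0 : V →L[ℝ] V), 0 < (1 + B).det := by
      refine hc.continuousAt.eventually (lt_mem_nhds ?_)
      have : (1 : V →L[ℝ] V).det = 1 := by
        simp [ContinuousLinearMap.det]
      simp [this]
    obtain ⟨δ, hδ, h⟩ := Metric.eventually_nhds_iff.1 h1
    exact ⟨δ, hδ, fun B hB => h (by simpa using hB)⟩
  obtain ⟨η, hη, hηK, hηM⟩ : ∃ η : ℝ, 0 < η ∧ (∀ t : ℝ, 0 ≤ t → t < η → t * K < 1) ∧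
      ∀ t : ℝ, 0 ≤ t → t < η → t * M < δ := by
    have h : ∀ (c e : ℝ), 0 < e → ∃ η > 0, ∀ t, 0 ≤ t → t < η → t * c < e := by
      intro c e he
      refine ⟨e / (|c| + 1), by positivity, fun t ht0 ht => ?_⟩
      rw [lt_div_iff₀ (by positivity)] at ht
      nlinarith [le_abs_self c]
    obtain ⟨a, ha, ha'⟩ := h K 1 one_pos
    obtain ⟨b, hb, hb'⟩ := h M δ hδ
    exact ⟨min a b, lt_min ha hb, fun t h0 ht => ha' t h0 (ht.trans_le (min_le_left _ _)),
      fun t h0 ht => hb' t h0 (ht.trans_le (min_le_right _ _))⟩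
  have hvol : ∀ t, 0 ≤ t → t < η →
      ∫ x in ball (0 : V) R, (1 + t • A x).det = (volume : Measure V).real (ball 0 R) := by
    intro t ht htη
    obtain ⟨hinj, himg⟩ := image_ball_one_add_smul hu hu0 ht (hηK t ht htη)
    have h := integral_image_eq_integral_abs_det_fderiv_smul (volume : Measure V)
      (f' := fun x => 1 + t • A x) measurableSet_ball
      (fun x hx => ((hasFDerivAt_id x).add ((huA x hx).const_smul t)).hasFDerivWithinAt)
      hinj.injOn (fun _ => (1 : ℝ))
    have hval : ∫ x in ball (0 : V) R, (1 + t • A x).det =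
        ∫ x in ball (0 : V) R, |(1 + t • A x).det| • (1 : ℝ) := by
      refine setIntegral_congr_fun measurableSet_ball fun x hx => ?_
      have hpos : 0 < (1 + t • A x).det := by
        refine hdet _ ?_
        rw [norm_smul, Real.norm_of_nonneg ht]
        exact (mul_le_mul_of_nonneg_left (hM x (ball_subset_closedBall hx)) ht).trans_lt
          (hηM t ht htη)
      simp [abs_of_pos hpos]
    rw [hval, ← h]
    have himg' : (id + t • u) '' ball 0 R = ball (0 : V) R := himg
    rw [himg']
    simp
  obtain ⟨s, hsη, hscard⟩ := (Ioo_infinite hη).exists_subset_card_eq (finrank ℝ V + 1)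
  have hint : ∀ t : ℝ, IntegrableOn (fun x => (1 + t • A x).det) (ball (0 : V) R) := by
    intro t
    have hc : Continuous fun x => (1 + t • A x).det :=
      ContinuousLinearMap.continuous_det.comp (continuous_const.add (hA.const_smul t))
    exact (hc.continuousOn.integrableOn_compact (isCompact_closedBall _ _)).mono_set
      ball_subset_closedBall
  have hrepr : ∀ x, (fderiv ℝ f x).det =
      ∑ t ∈ s, (Lagrange.basis s id t).eval 1 * (1 + t • A x).det := by
    intro x
    rw [← det_one_add_eq_sum_lagrange (A x) (by omega)]
    simp [A]
  simp_rw [hrepr]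
  rw [integral_finsetSum _ fun t _ => (hint t).const_mul _]
  simp_rw [integral_const_mul]
  rw [Finset.sum_congr rfl fun t ht => by rw [hvol t (hsη ht).1.le (hsη ht).2], ← Finset.sum_mul,
    sum_lagrange_basis_eval (Finset.card_pos.1 (by omega)), one_mul]

/-- The Jacobian of a map into a sphere vanishes identically, because the derivative takes values
orthogonal to `f x`; this contradicts `setIntegral_det_fderiv_eq_volume`. -/
theorem not_retraction_onto_sphere {R : ℝ} (hR : 0 < R) {f : V → V} (hf : ContDiff ℝ 1 f)
    (hnorm : ∀ x, ‖f x‖ = R) (hid : ∀ x, ‖x‖ = R → f x = x) : False := by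
  borelize V
  have hdet : ∀ x, (fderiv ℝ f x).det = 0 := by
    intro x
    by_contra hne
    have hunit : IsUnit (LinearMap.det (fderiv ℝ f x : V →ₗ[ℝ] V)) := isUnit_iff_ne_zero.2 hne
    obtain ⟨v, hv⟩ := (LinearMap.equivOfIsUnitDet hunit).surjective (f x)
    have hv' : fderiv ℝ f x v = f x := by simpa using hv
    have h1 : HasFDerivAt (fun y => ⟪f y, f y⟫) _ x :=
      (hf.differentiable one_ne_zero x).hasFDerivAt.inner ℝ
        (hf.differentiable one_ne_zero x).hasFDerivAt
    have h2 : HasFDerivAt (fun y => ⟪f y, f y⟫) (0 : V →L[ℝ] ℝ) x := by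
      simp_rw [real_inner_self_eq_norm_sq, hnorm]
      exact hasFDerivAt_const _ _
    have h3 := congrArg (fun L : V →L[ℝ] ℝ => L v) (h1.unique h2)
    simp [hv', hnorm, hR.ne'] at h3
  have h := setIntegral_det_fderiv_eq_volume hf hid
  simp_rw [hdet, integral_zero] at h
  have hpos : 0 < (volume : Measure V).real (ball 0 R) :=
    ENNReal.toReal_pos (measure_ball_pos _ _ hR).ne' measure_ball_lt_top.ne
  exact hpos.ne h

end NoRetraction

/-! ### Radial pushing out of a ball -/

section PushOut

variable {V : Type*} [NormedAddCommGroup V] [NormedSpace ℝ V]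

/-- The map that fixes all points at distance at least `ε` from `c`, and moves the other points
radially onto the sphere of radius `ε` about `c`. At `c` itself, where the quotient is `ε / 0 = 0`,
its value is `c`, and it is discontinuous there if `ε > 0` and the space is nontrivial. -/
noncomputable def pushOut (c : V) (ε : ℝ) (y : V) : V := c + max 1 (ε / ‖y - c‖) • (y - c)

theorem pushOut_of_le {c : V} {ε : ℝ} (hε : 0 < ε) {y : V} (h : ε ≤ ‖y - c‖) :
    pushOut c ε y = y := by
  have : ε / ‖y - c‖ ≤ 1 := (div_le_one (hε.trans_le h)).2 h
  simp [pushOut, this]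

theorem pushOut_mem_sphere {c : V} {ε : ℝ} (hε : 0 < ε) {y : V} (h : ‖y - c‖ ≤ ε) (hy : y ≠ c) :
    pushOut c ε y ∈ sphere c ε := by
  have hpos : 0 < ‖y - c‖ := norm_pos_iff.2 (sub_ne_zero.2 hy)
  have : 1 ≤ ε / ‖y - c‖ := (one_le_div hpos).2 h
  rw [mem_sphere_iff_norm, pushOut, max_eq_right this, add_sub_cancel_left, norm_smul,
    Real.norm_of_nonneg (by positivity)]
  field_simp

theorem dist_pushOut_le {c : V} {ε : ℝ} (hε : 0 < ε) (y : V) : dist (pushOut c ε y) y ≤ ε := by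
  rcases le_or_gt ε ‖y - c‖ with h | h
  · rw [pushOut_of_le hε h, dist_self]
    exact hε.le
  rcases eq_or_ne y c with rfl | hy
  · simp [pushOut, hε.le]
  have hpos : 0 < ‖y - c‖ := norm_pos_iff.2 (sub_ne_zero.2 hy)
  have h1 : 1 ≤ ε / ‖y - c‖ := (one_le_div hpos).2 h.le
  have h2 : pushOut c ε y - y = (ε / ‖y - c‖ - 1) • (y - c) := by
    rw [pushOut, max_eq_right h1, sub_smul, one_smul]
    abel
  rw [dist_eq_norm, h2, norm_smul, Real.norm_of_nonneg (by linarith), sub_mul, one_mul,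
    div_mul_cancel₀ _ hpos.ne']
  linarith

theorem continuousOn_pushOut (c : V) (ε : ℝ) : ContinuousOn (pushOut c ε) {c}ᶜ := by
  have h1 : ContinuousOn (fun y : V => y - c) {c}ᶜ :=
    (continuous_id.sub continuous_const).continuousOn
  refine continuousOn_const.add (ContinuousOn.smul ?_ h1)
  refine ContinuousOn.sup continuousOn_const (continuousOn_const.div h1.norm fun y hy => ?_)
  exact norm_ne_zero_iff.2 (sub_ne_zero.2 hy)

end PushOut

/-! ### Zeros of maps close to the identity, and coarse invariance of domain -/

section CoarseInvarianceOfDomain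

variable {V : Type*} [NormedAddCommGroup V] [InnerProductSpace ℝ V] [FiniteDimensional ℝ V]

theorem exists_contDiff_approx_on_closedBall {R ε : ℝ} (hε : 0 < ε) {H : V → V}
    (hH : ContinuousOn H (closedBall 0 R)) :
    ∃ h : V → V, ContDiff ℝ 1 h ∧ ∀ x ∈ closedBall (0 : V) R, dist (h x) (H x) < ε := by
  obtain ⟨g, hg⟩ := ContinuousMap.exists_restrict_eq (isClosed_closedBall (x := (0 : V)) (ε := R))
    ⟨_, hH.domRestrict⟩
  have hdense := ContinuousMap.dense_setOfPred_contDiff (E := V) (F := V) g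
  rw [mem_closure_iff_nhds_basis
    (nhds_basis_uniformity Metric.uniformity_basis_dist.compactConvergenceUniformity)] at hdense
  obtain ⟨h, hh, hgh⟩ := hdense (closedBall 0 R, ε) ⟨isCompact_closedBall _ _, hε⟩
  have hh' : ContDiff ℝ ∞ h := by simpa using hh
  refine ⟨h, hh'.of_le (by norm_cast), fun x hx => ?_⟩
  have hgx : g x = H x := congrArg (fun k : C(closedBall (0 : V) R, V) => k ⟨x, hx⟩) hg
  rw [← hgx]
  exact hgh x hx

/-- A map with no zero could be smoothed, interpolated with the identity near the sphere, and
normalised, which would give a retraction onto the sphere. -/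
theorem exists_zero_of_norm_sub_le {R : ℝ} (hR : 0 < R) {H : V → V}
    (hH : ContinuousOn H (closedBall 0 R))
    (hclose : ∀ x ∈ closedBall (0 : V) R, ‖H x - x‖ ≤ R / 2) :
    ∃ x ∈ closedBall (0 : V) R, H x = 0 := by
  by_contra! hne
  obtain ⟨x₀, hx₀, hmin⟩ := (isCompact_closedBall (0 : V) R).exists_isMinOn
    ⟨0, mem_closedBall_self hR.le⟩ hH.norm
  have hδ : 0 < ‖H x₀‖ := norm_pos_iff.2 (hne x₀ hx₀)
  obtain ⟨h, hh, hhH⟩ := exists_contDiff_approx_on_closedBall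
    (lt_min hδ (show 0 < R / 8 by positivity)) hH
  let χ : ContDiffBump (0 : V) := ⟨3 * R / 4, R, by positivity, by linarith⟩
  -- `W` is the identity off the ball. Inside it, `W` is the approximation `h` up to radius `3R/4`;
  -- beyond that radius the displacement, at most `R/2 + R/8`, is too small to reach the origin.
  let W : V → V := fun x => x + χ x • (h x - x)
  have hW : ContDiff ℝ 1 W := contDiff_id.add (χ.contDiff.smul (hh.sub contDiff_id))
  have hWout : ∀ x, R ≤ ‖x‖ → W x = x := by
    intro x hx
    have : χ x = 0 := χ.zero_of_le_dist (by simpa [χ] using hx)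
    simp [W, this]
  have hWne : ∀ x, W x ≠ 0 := by
    intro x
    rcases le_or_gt ‖x‖ R with hxR | hxR
    · have hx : x ∈ closedBall (0 : V) R := by simpa using hxR
      have hd := hhH x hx
      rw [lt_min_iff] at hd
      rcases le_or_gt ‖x‖ (3 * R / 4) with hxs | hxs
      · have hχ : χ x = 1 := χ.one_of_mem_closedBall (by simpa [χ] using hxs)
        have hWx : W x = h x := by simp [W, hχ]
        rw [hWx]
        intro h0
        have := hmin hx
        simp only [mem_ofPred_eq] at this
        rw [h0, dist_zero_left] at hd
        linarith [hd.1]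
      · intro h0
        have h1 : x = -(χ x • (h x - x)) := eq_neg_of_add_eq_zero_left h0
        have h2 : ‖x‖ ≤ ‖h x - x‖ := by
          calc ‖x‖ = ‖χ x • (h x - x)‖ := (congrArg norm h1).trans (norm_neg _)
            _ = χ x * ‖h x - x‖ := by rw [norm_smul, Real.norm_of_nonneg χ.nonneg]
            _ ≤ ‖h x - x‖ := mul_le_of_le_one_left (norm_nonneg _) χ.le_one
        have h3 : ‖h x - x‖ ≤ ‖h x - H x‖ + ‖H x - x‖ := norm_sub_le_norm_sub_add_norm_sub _ _ _
        rw [dist_eq_norm] at hd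
        linarith [hclose x hx, hd.2]
    · rw [hWout x hxR.le]
      exact norm_pos_iff.1 (hR.trans hxR)
  refine not_retraction_onto_sphere hR (f := fun x => (R * ‖W x‖⁻¹) • W x) ?_ ?_ ?_
  · exact (contDiff_const.mul ((hW.norm ℝ hWne).inv fun x => norm_ne_zero_iff.2 (hWne x))).smul hW
  · intro x
    have := norm_ne_zero_iff.2 (hWne x)
    rw [norm_smul, norm_mul, norm_inv, norm_norm, Real.norm_of_nonneg hR.le]
    field_simp
  · intro x hx
    rw [hWout x hx.ge, hx, mul_inv_cancel₀ hR.ne', one_smul]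

/-- The sphere is null for the Hausdorff measure in the dimension of `V`, and hence so is its
Lipschitz image, which therefore cannot contain the unit ball. -/
theorem exists_norm_lt_one_notMem_image_sphere {K : ℝ≥0} {G : V → V} (hG : LipschitzWith K G)
    (c : V) {ε : ℝ} (hε : ε ≠ 0) : ∃ v, ‖v‖ < 1 ∧ v ∉ G '' sphere c ε := by
  borelize V
  by_contra! hcon
  have h1 : (μH[finrank ℝ V] : Measure V) (G '' sphere c ε) ≤ 0 := by
    refine (hG.hausdorffMeasure_image_le (Nat.cast_nonneg _) _).trans ?_
    rw [Measure.addHaar_sphere_of_ne_zero _ _ hε, mul_zero]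
  have h2 : (μH[finrank ℝ V] : Measure V) (ball 0 1) ≤ 0 :=
    (measure_mono fun v hv => hcon v (by simpa using hv)).trans h1
  exact (measure_ball_pos (μH[finrank ℝ V] : Measure V) 0 one_pos).not_ge h2

/-- Coarsely Lipschitz maps into Euclidean space are at bounded distance from Lipschitz maps: such a
map is Lipschitz on a maximal `1`-separated set, and its restriction to that set is extended
coordinatewise. The constants depend only on `p` and `K`. -/
theorem exists_lipschitzWith_approx (p : ℕ) {K : ℝ} (hK : 0 ≤ K) : ∃ L : ℝ≥0, ∃ M : ℝ, 0 ≤ M ∧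
    ∀ (S : Set (EuclideanSpace ℝ (Fin p)))
      (φ : EuclideanSpace ℝ (Fin p) → EuclideanSpace ℝ (Fin p)),
      (∀ x ∈ S, ∀ y ∈ S, dist (φ x) (φ y) ≤ K * dist x y + K) →
      ∃ ψ : EuclideanSpace ℝ (Fin p) → EuclideanSpace ℝ (Fin p),
        LipschitzWith L ψ ∧ ∀ x ∈ S, dist (ψ x) (φ x) ≤ M := by
  let e := EuclideanSpace.equiv (Fin p) ℝ
  let K₂ : ℝ≥0 := ⟨2 * K, by positivity⟩
  let A : ℝ≥0 := ‖(e : EuclideanSpace ℝ (Fin p) →L[ℝ] Fin p → ℝ)‖₊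
  let A' : ℝ≥0 := ‖(e.symm : (Fin p → ℝ) →L[ℝ] EuclideanSpace ℝ (Fin p))‖₊
  let L : ℝ≥0 := A' * (A * K₂)
  refine ⟨L, L + 2 * K, by positivity, fun S φ hφ => ?_⟩
  obtain ⟨N, hN⟩ : ∃ N, Maximal (fun N => N ⊆ S ∧ IsSeparated ((1 : ℝ≥0) : ℝ≥0∞) N) N := by
    obtain ⟨N, -, hN⟩ := zorn_subset_nonempty {N | N ⊆ S ∧ IsSeparated ((1 : ℝ≥0) : ℝ≥0∞) N}
      (fun c hc hchain _ => ⟨⋃₀ c, ⟨sUnion_subset fun s hs => (hc hs).1,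
        (pairwise_sUnion hchain.directedOn).2 fun s hs => (hc hs).2⟩,
        fun s hs => subset_sUnion_of_mem hs⟩) ∅ ⟨empty_subset _, IsSeparated.empty⟩
    exact ⟨N, hN⟩
  have hcover : IsCover 1 S N := IsCover.of_maximal_isSeparated hN
  have hLip : LipschitzOnWith K₂ φ N := by
    refine LipschitzOnWith.of_dist_le_mul fun x hx y hy => ?_
    rcases eq_or_ne x y with rfl | hxy
    · simp
    have h1 : 1 ≤ dist x y := by
      have : ((1 : ℝ≥0) : ℝ≥0∞) < edist x y := hN.prop.2 hx hy hxy
      rw [edist_nndist, ENNReal.coe_lt_coe] at this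
      exact_mod_cast this.le
    have h2 := hφ x (hN.prop.1 hx) y (hN.prop.1 hy)
    change _ ≤ 2 * K * dist x y
    nlinarith
  have heL : LipschitzOnWith (A * K₂) (e ∘ φ) N :=
    (ContinuousLinearMap.lipschitz (e : EuclideanSpace ℝ (Fin p) →L[ℝ] Fin p → ℝ)
      ).comp_lipschitzOnWith hLip
  obtain ⟨g, hg, hgN⟩ := heL.extend_pi
  have hψ : LipschitzWith L (e.symm ∘ g) :=
    (ContinuousLinearMap.lipschitz (e.symm : (Fin p → ℝ) →L[ℝ] EuclideanSpace ℝ (Fin p))).comp hg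
  have hψN : ∀ n ∈ N, e.symm (g n) = φ n := fun n hn => by
    rw [← hgN hn]
    exact e.symm_apply_apply _
  refine ⟨e.symm ∘ g, hψ, fun x hx => ?_⟩
  obtain ⟨n, hn, hxn⟩ := hcover hx
  have hxn' : dist x n ≤ 1 := by
    have h : edist x n ≤ 1 := hxn
    rw [edist_nndist] at h
    exact_mod_cast h
  have h1 : dist ((e.symm ∘ g) x) (φ n) ≤ L * dist x n := by
    rw [← hψN n hn]
    exact hψ.dist_le_mul x n
  have h2 := hφ n (hN.prop.1 hn) x hx
  have h3 := dist_triangle ((e.symm ∘ g) x) (φ n) (φ x)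
  rw [dist_comm n x] at h2
  have h4 : (L : ℝ) * dist x n ≤ L := mul_le_of_le_one_right L.2 hxn'
  nlinarith

/-- Coarse invariance of domain: a coarse embedding of the ball of radius `R` in `ℝᵖ` into `ℝᵖ` is
coarsely onto a ball about the image of the centre, whose radius grows linearly in `R`. The error
`K'` depends only on `p` and `K`. -/
theorem exists_dist_le_of_coarse_embedding (p : ℕ) {K : ℝ} (hK : 0 ≤ K) : ∃ K' : ℝ, 0 ≤ K' ∧
    ∀ (R : ℝ) (φ : EuclideanSpace ℝ (Fin p) → EuclideanSpace ℝ (Fin p)),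
      (∀ x ∈ closedBall 0 R, ∀ y ∈ closedBall 0 R, dist (φ x) (φ y) ≤ K * dist x y + K) →
      (∀ x ∈ closedBall 0 R, ∀ y ∈ closedBall 0 R, dist x y ≤ K * dist (φ x) (φ y) + K) →
      ∀ c, K' * (dist c (φ 0) + 1) ≤ R → ∃ x ∈ closedBall 0 R, dist (φ x) c ≤ K' := by
  obtain ⟨L, M, hM, happ⟩ := exists_lipschitzWith_approx p hK
  set K₂ : ℝ := L * M + M + K with hK₂
  -- `r₀` is chosen so that `r₀ ≤ dist (ψ x) (ψ 0)` forces `‖x‖ > K₂ + 1`, whence `‖G (ψ x)‖ > 1`.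
  set r₀ : ℝ := L * (K₂ + 1) + 1 with hr₀
  have hL : (0 : ℝ) ≤ L := L.2
  have hK₂0 : 0 ≤ K₂ := by positivity
  have hr₀0 : 0 < r₀ := by positivity
  refine ⟨2 * (L * (1 + M + r₀) + K₂ + 1) + M, by positivity, fun R φ hφ hφ' c hc => ?_⟩
  have hd : 0 ≤ dist c (φ 0) := dist_nonneg
  have hRbound : 2 * (L * (dist c (φ 0) + M + r₀) + K₂ + 1) ≤ R := by
    refine le_trans ?_ hc
    have : 0 ≤ (2 * (L * (M + r₀) + K₂ + 1) + M) * dist c (φ 0) := by positivity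
    nlinarith
  have hR : 0 < R := lt_of_lt_of_le (by positivity) hRbound
  have h0 : (0 : EuclideanSpace ℝ (Fin p)) ∈ closedBall 0 R := mem_closedBall_self hR.le
  obtain ⟨ψ, hψ, hψφ⟩ := happ _ φ hφ
  let γ : EuclideanSpace ℝ (Fin p) → EuclideanSpace ℝ (Fin p) :=
    Function.invFunOn φ (closedBall 0 R)
  have hγmem : ∀ y ∈ φ '' closedBall 0 R, γ y ∈ closedBall 0 R :=
    fun y hy => Function.invFunOn_mem hy
  have hγeq : ∀ y ∈ φ '' closedBall 0 R, φ (γ y) = y := fun y hy => Function.invFunOn_eq hy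
  obtain ⟨G, hG, hGγ⟩ := happ (φ '' closedBall 0 R) γ fun y hy y' hy' => by
    have := hφ' _ (hγmem y hy) _ (hγmem y' hy')
    rwa [hγeq y hy, hγeq y' hy'] at this
  have hGψ : ∀ x ∈ closedBall 0 R, dist (G (ψ x)) x ≤ K₂ := by
    intro x hx
    have hy := mem_image_of_mem φ hx
    have h1 : dist (G (ψ x)) (G (φ x)) ≤ L * M :=
      (hG.dist_le_mul _ _).trans (mul_le_mul_of_nonneg_left (hψφ x hx) hL)
    have h2 := hGγ _ hy
    have h3 := hφ' _ (hγmem _ hy) x hx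
    rw [hγeq _ hy, dist_self, mul_zero, zero_add] at h3
    have h4 := dist_triangle4 (G (ψ x)) (G (φ x)) (γ (φ x)) x
    linarith
  by_cases hcψ : ∃ x ∈ closedBall 0 R, ψ x = c
  · obtain ⟨x, hx, rfl⟩ := hcψ
    refine ⟨x, hx, ?_⟩
    rw [dist_comm]
    have := hψφ x hx
    have h2 : 0 ≤ L * (1 + M + r₀) + K₂ + 1 := by positivity
    linarith
  push Not at hcψ
  exfalso
  -- Outside the ball of radius `ε` about `c`, every point is at distance at least `r₀` from `ψ 0`.
  set ε : ℝ := dist c (ψ 0) + r₀ with hε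
  have hε0 : 0 < ε := by positivity
  have hεle : ε ≤ dist c (φ 0) + M + r₀ := by
    have h1 := dist_triangle c (φ 0) (ψ 0)
    have h2 := hψφ 0 h0
    rw [dist_comm] at h2
    linarith
  obtain ⟨v, hv1, hv⟩ := exists_norm_lt_one_notMem_image_sphere hG c hε0.ne'
  obtain ⟨x, hx, hHx⟩ := exists_zero_of_norm_sub_le hR
    (H := fun x => G (pushOut c ε (ψ x)) - v)
    ((hG.continuous.comp_continuousOn ((continuousOn_pushOut c ε).comp hψ.continuous.continuousOn
      fun x hx => hcψ x hx)).sub continuousOn_const)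
    (fun x hx => by
      have h1 : dist (G (pushOut c ε (ψ x))) (G (ψ x)) ≤ L * ε :=
        (hG.dist_le_mul _ _).trans (mul_le_mul_of_nonneg_left (dist_pushOut_le hε0 _) hL)
      have h2 := hGψ x hx
      have h3 := dist_triangle (G (pushOut c ε (ψ x))) (G (ψ x)) x
      have h4 : ‖G (pushOut c ε (ψ x)) - v - x‖ ≤ ‖G (pushOut c ε (ψ x)) - x‖ + ‖v‖ := by
        rw [sub_right_comm]
        exact norm_sub_le _ _
      rw [dist_eq_norm _ x] at h3
      have h5 : L * ε ≤ L * (dist c (φ 0) + M + r₀) := mul_le_mul_of_nonneg_left hεle hL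
      linarith)
  have hGv : G (pushOut c ε (ψ x)) = v := sub_eq_zero.1 hHx
  -- If `ψ x` is not moved, then `‖G (ψ x)‖ = ‖v‖ < 1`, against the choice of `r₀`. Otherwise `v`
  -- lies in the image of the sphere, against the choice of `v`.
  rcases le_or_gt ε ‖ψ x - c‖ with h | h
  · rw [pushOut_of_le hε0 h] at hGv
    have h1 := hGψ x hx
    rw [hGv] at h1
    have h2 : ‖x‖ ≤ K₂ + 1 := by
      have h3 := dist_triangle x v 0
      rw [dist_zero_right, dist_zero_right, dist_comm] at h3
      linarith
    have h4 := hψ.dist_le_mul x 0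
    rw [dist_zero_right] at h4
    have h5 := dist_triangle (ψ x) (ψ 0) c
    rw [← dist_eq_norm] at h
    rw [dist_comm (ψ 0) c] at h5
    have h6 : L * ‖x‖ ≤ L * (K₂ + 1) := mul_le_mul_of_nonneg_left h2 hL
    linarith
  · exact hv ⟨_, pushOut_mem_sphere hε0 h.le (hcψ x hx), hGv⟩

end CoarseInvarianceOfDomain

/-! ### Intervals and coarse maps -/

theorem exists_dist_le_of_mem_cthickening {X : Type*} [MetricSpace X] {C : ℝ} (hC : 0 ≤ C)
    {A : Set X} {x : X} (hx : x ∈ cthickening C A) : ∃ y ∈ A, dist x y ≤ C + 1 := by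
  have h := cthickening_subset_thickening' (by linarith) (lt_add_one C) A hx
  obtain ⟨y, hy, hxy⟩ := mem_thickening_iff.1 h
  exact ⟨y, hy, hxy.le⟩

namespace IsCoarseMedian

variable {X : Type*} [MetricSpace X] {C : ℝ} {μ : X → X → X → X}

theorem dist_right_le (h : IsCoarseMedian C μ) (x y y' z : X) :
    dist (μ x y z) (μ x y' z) ≤ C * dist y y' + C := by
  rw [h.symm_left x y, h.symm_left x y']
  exact h.coarse_lipschitz y x z y'

theorem dist_left_le (h : IsCoarseMedian C μ) (x y z : X) :
    dist (μ x y z) x ≤ C * dist x y + C := by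
  have := h.dist_right_le x y x z
  rwa [h.localisation, dist_comm y x] at this

end IsCoarseMedian

theorem isQIEmbedding_bounds {Y Z : Type*} [MetricSpace Y] [MetricSpace Z] {C : ℝ} (hC : 0 < C)
    {f : Y → Z} (hf : IsQIEmbedding C f) (a b : Y) :
    dist (f a) (f b) ≤ C * dist a b + C ∧ dist a b ≤ C * (dist (f a) (f b) + C) := by
  refine ⟨(hf a b).2, ?_⟩
  have := (hf a b).1
  rw [sub_le_iff_le_add, inv_mul_le_iff₀ hC] at this
  exact this

end CoarseMedian

/-! ### Quasiconvexity of coarse flats -/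

open CoarseMedian Metric Set

theorem mainTheorem5 (C : ℝ) (hC : 0 ≤ C) (p : ℕ) :
    ∃ C₁ : ℝ, 0 ≤ C₁ ∧
      ∀ (X : Type u) [MetricSpace X] (μ : X → X → X → X) (E : Set X),
        CoarseMedian.IsCoarseMedian C μ →
        (∃ f : E → EuclideanSpace ℝ (Fin p), CoarseMedian.IsQuasiIsometry C f) →
        (∀ B : Set X, B ⊆ E → Bornology.IsBounded B →
          ∃ Y : Set X, B ⊆ Metric.cthickening C Y ∧ CoarseMedian.IsQuasiconvex μ C Y ∧
            ∃ g : Y → EuclideanSpace ℝ (Fin p), CoarseMedian.IsQIEmbedding C g) →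
        CoarseMedian.IsQuasiconvex μ C₁ E := by
  set K : ℝ := C ^ 2 + (C * (3 * C ^ 2 + 2 * (C + 1)) + C) +
    (3 * C + C * (C ^ 2 + 2 * (C + 1))) with hK
  have hK0 : 0 ≤ K := by positivity
  obtain ⟨K', hK', hcoarse⟩ := exists_dist_le_of_coarse_embedding p hK0
  set T : ℝ := 2 * (C * (C + 1) + C) with hT
  refine ⟨(C + 1) + C * (K' + C) + (C + 1) + T, by positivity, ?_⟩
  intro X _ μ E hμ ⟨f, hf, hfsurj⟩ hY a₁ ha₁ a₂ ha₂
  rintro _ ⟨z, rfl⟩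
  simp only
  have hC0 : 0 < C := zero_lt_one.trans_le hμ.one_le
  -- `s` is a coarse inverse of `f`.
  choose s hs using hfsurj
  have hs_upper : ∀ w w', dist (s w) (s w') ≤ C * (dist w w' + 3 * C) := by
    intro w w'
    refine (isQIEmbedding_bounds hC0 hf _ _).2.trans (mul_le_mul_of_nonneg_left ?_ hC)
    have := dist_triangle4 (f (s w)) w w' (f (s w'))
    have h2 := hs w'
    rw [dist_comm] at h2
    linarith [hs w]
  have hs_lower : ∀ w w', dist w w' ≤ C * dist (s w) (s w') + 3 * C := by
    intro w w'
    have := dist_triangle4 w (f (s w)) (f (s w')) w'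
    have h2 := hs w
    rw [dist_comm] at h2
    linarith [hs w', (isQIEmbedding_bounds hC0 hf (s w) (s w')).1]
  set o := f ⟨a₁, ha₁⟩ with ho
  have hso : dist a₁ (s o) ≤ C * (2 * C) := by
    have h1 := (isQIEmbedding_bounds hC0 hf ⟨a₁, ha₁⟩ (s o)).2
    have h2 := hs o
    rw [dist_comm] at h2
    refine h1.trans (mul_le_mul_of_nonneg_left ?_ hC)
    linarith
  -- `T` bounds the change of `μ a₁ a₂ z` when `a₁, a₂` are replaced by nearby points of `Y`, and
  -- `Q` bounds the distance from `a₁` to the point of `Y` near `μ a₁ a₂ z`.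
  set Q : ℝ := (C + 1) + T + (C * dist a₁ a₂ + C) with hQ
  set R : ℝ := K' * (C * (Q + C * (2 * C) + (C + 1)) + C + 1) with hR
  have hR0 : 0 ≤ R := by positivity
  -- `a₁` and `a₂` need not be values of `s`, so they are added by hand.
  set B : Set X := (fun w => (s w : X)) '' closedBall o R ∪ {a₁, a₂} with hB
  have hBE : B ⊆ E := by
    rintro _ (⟨w, -, rfl⟩ | rfl | rfl)
    exacts [(s w).2, ha₁, ha₂]
  have hBbdd : Bornology.IsBounded B := by
    refine Bornology.IsBounded.union (isBounded_iff.2 ⟨C * (2 * R + 3 * C), ?_⟩)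
      (Set.toFinite _).isBounded
    rintro _ ⟨w, hw, rfl⟩ _ ⟨w', hw', rfl⟩
    refine (hs_upper w w').trans (mul_le_mul_of_nonneg_left ?_ hC)
    linarith [dist_triangle_right w w' o, mem_closedBall.1 hw, mem_closedBall.1 hw']
  obtain ⟨Y, hBY, hYq, g, hg⟩ := hY B hBE hBbdd
  have ha₁B : a₁ ∈ B := Or.inr (Or.inl rfl)
  have ha₂B : a₂ ∈ B := Or.inr (Or.inr rfl)
  have hproj : ∀ b : X, ∃ y : Y, b ∈ B → dist b y ≤ C + 1 := by
    intro b
    by_cases hb : b ∈ B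
    · obtain ⟨y, hy, hby⟩ := exists_dist_le_of_mem_cthickening hC (hBY hb)
      exact ⟨⟨y, hy⟩, fun _ => hby⟩
    · obtain ⟨y, hy, -⟩ := exists_dist_le_of_mem_cthickening hC (hBY ha₁B)
      exact ⟨⟨y, hy⟩, fun h => absurd h hb⟩
  -- `π` is a coarse projection of `B` to `Y`, with arbitrary values off `B`.
  choose π hπ using hproj
  have hπ_upper : ∀ a ∈ B, ∀ b ∈ B, dist (π a) (π b) ≤ dist a b + 2 * (C + 1) := by
    intro a ha b hb
    have h1 := dist_triangle4 (π a : X) a b (π b)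
    have h2 := hπ a ha
    rw [dist_comm] at h2
    rw [Subtype.dist_eq]
    linarith [hπ b hb]
  have hπ_lower : ∀ a ∈ B, ∀ b ∈ B, dist a b ≤ dist (π a) (π b) + 2 * (C + 1) := by
    intro a ha b hb
    have h1 := dist_triangle4 a (π a : X) (π b) b
    have h2 := hπ b hb
    rw [dist_comm] at h2
    rw [Subtype.dist_eq]
    linarith [hπ a ha]
  have hsB : ∀ x ∈ closedBall (0 : EuclideanSpace ℝ (Fin p)) R, (s (x + o) : X) ∈ B :=
    fun x hx => Or.inl ⟨x + o, by simpa [mem_closedBall_iff_norm] using hx, rfl⟩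
  -- The composite `ball → B → Y → ℝᵖ`, recentred so that its ball has centre `0`.
  let φ : EuclideanSpace ℝ (Fin p) → EuclideanSpace ℝ (Fin p) := fun x => g (π (s (x + o)))
  have hφ_upper : ∀ x ∈ closedBall 0 R, ∀ x' ∈ closedBall 0 R,
      dist (φ x) (φ x') ≤ K * dist x x' + K := by
    intro x hx x' hx'
    have h1 := (isQIEmbedding_bounds hC0 hg (π (s (x + o))) (π (s (x' + o)))).1
    have h2 := hπ_upper _ (hsB x hx) _ (hsB x' hx')
    have h3 := hs_upper (x + o) (x' + o)
    rw [dist_add_right] at h3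
    have h4 : dist (φ x) (φ x') ≤ C * (C * (dist x x' + 3 * C) + 2 * (C + 1)) + C := by
      refine h1.trans ?_
      gcongr
      exact h2.trans (by gcongr; exact h3)
    refine h4.trans ?_
    have h5 : 0 ≤ (K - C ^ 2) * dist x x' :=
      mul_nonneg (by rw [hK]; ring_nf; positivity) dist_nonneg
    have h6 : C * (3 * C ^ 2 + 2 * (C + 1)) + C ≤ K := by
      rw [hK]
      have : 0 ≤ C ^ 2 + (3 * C + C * (C ^ 2 + 2 * (C + 1))) := by positivity
      linarith
    linarith
  have hφ_lower : ∀ x ∈ closedBall 0 R, ∀ x' ∈ closedBall 0 R,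
      dist x x' ≤ K * dist (φ x) (φ x') + K := by
    intro x hx x' hx'
    have h1 := (isQIEmbedding_bounds hC0 hg (π (s (x + o))) (π (s (x' + o)))).2
    have h2 := hπ_lower _ (hsB x hx) _ (hsB x' hx')
    have h3 := hs_lower (x + o) (x' + o)
    rw [dist_add_right] at h3
    have h4 : dist x x' ≤ C * (C * (dist (φ x) (φ x') + C) + 2 * (C + 1)) + 3 * C := by
      refine h3.trans ?_
      gcongr
      exact h2.trans (by gcongr)
    refine h4.trans ?_
    have h5 : 0 ≤ (K - C ^ 2) * dist (φ x) (φ x') :=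
      mul_nonneg (by rw [hK]; ring_nf; positivity) dist_nonneg
    have h6 : 3 * C + C * (C ^ 2 + 2 * (C + 1)) ≤ K := by
      rw [hK]
      have : 0 ≤ C ^ 2 + (C * (3 * C ^ 2 + 2 * (C + 1)) + C) := by positivity
      linarith
    linarith
  -- The median of the projections lies near `Y` by quasiconvexity, and `μ a₁ a₂ z` lies near it.
  obtain ⟨y, hyY, hy⟩ := exists_dist_le_of_mem_cthickening hC
    (hYq _ (π a₁).2 _ (π a₂).2 ⟨z, rfl⟩)
  simp only at hy
  have hm : dist (μ a₁ a₂ z) (μ (π a₁) (π a₂) z) ≤ T := by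
    have h1 := hμ.coarse_lipschitz a₁ a₂ z (π a₁)
    have h2 := hμ.dist_right_le (π a₁) a₂ (π a₂) z
    have h3 := dist_triangle (μ a₁ a₂ z) (μ (π a₁) a₂ z) (μ (π a₁) (π a₂) z)
    have h4 := mul_le_mul_of_nonneg_left (hπ a₁ ha₁B) hC
    have h5 := mul_le_mul_of_nonneg_left (hπ a₂ ha₂B) hC
    linarith
  have hmy : dist (μ a₁ a₂ z) y ≤ T + (C + 1) := (dist_triangle _ _ _).trans (add_le_add hm hy)
  have hya₁ : dist y a₁ ≤ Q := by
    have := dist_triangle_left y a₁ (μ a₁ a₂ z)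
    linarith [hμ.dist_left_le a₁ a₂ z]
  have hgy : K' * (dist (g ⟨y, hyY⟩) (φ 0) + 1) ≤ R := by
    refine mul_le_mul_of_nonneg_left (add_le_add_left ?_ 1) hK'
    refine (isQIEmbedding_bounds hC0 hg _ _).1.trans ?_
    gcongr
    rw [zero_add, Subtype.dist_eq]
    have h1 := dist_triangle4 y a₁ (s o) (π (s o))
    have h2 := hsB 0 (mem_closedBall_self hR0)
    rw [zero_add] at h2
    linarith [hπ _ h2]
  obtain ⟨x, hx, hxy⟩ := hcoarse R φ hφ_upper hφ_lower (g ⟨y, hyY⟩) hgy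
  refine mem_cthickening_of_dist_le _ (s (x + o) : X) _ _ (s (x + o)).2 ?_
  have h1 := (isQIEmbedding_bounds hC0 hg (π (s (x + o))) ⟨y, hyY⟩).2
  rw [Subtype.dist_eq] at h1
  have h2 : C * (dist (g (π (s (x + o)))) (g ⟨y, hyY⟩) + C) ≤ C * (K' + C) := by gcongr
  have h3 := dist_triangle4 (s (x + o) : X) (π (s (x + o))) y (μ a₁ a₂ z)
  rw [dist_comm y, dist_comm _ (μ a₁ a₂ z)] at h3
  linarith [hπ _ (hsB x hx)]
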